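/- Let $d$ be a natural number and let $\Pi_1,\dots,\Pi_{d^2}$ be a SIC set in dimension $d$: each $\Pi_r$ is a rank-one orthogonal projection on $\mathbb{C}^d$, $\operatorname{Tr}(\Pi_r^2)=1$, and $\operatorname{Tr}(\Pi_r\Pi_s)=\frac{1}{d+1}$ for $r\neq s$. Let $\|1\rangle\!\rangle,\dots,\|d^2\rangle\!\rangle$ be the standard basis of $\mathbb{C}^{d^2}$. Let $K_{rs}=\sqrt{\frac{d\delta_{rs}+1}{d+1}}$ and $\|e_r\rangle\!\rangle=\sqrt{\frac{d+1}{2d}}\sum_{s}K_{rs}^2\|s\rangle\!\rangle$, let $T_r$ be the $d^2\times d^2$ matrix with entries $(T_r)_{st}=\operatorname{Tr}(\Pi_r\Pi_s\Pi_t)$, and set $$Q_r=\frac{d+1}{d}\,T_r-2\,\|e_r\rangle\!\rangle\langle\!\langle e_r\|,\qquad \|f_{rs}\rangle\!\rangle=i\sqrt{d+1}\;Q_r\|s\rangle\!\rangle,\qquad \|f^*_{rs}\rangle\!\rangle=-i\sqrt{d+1}\;Q_r^{\mathrm T}\|s\rangle\!\rangle .$$ Let $\mathcal{Q}_r$, $\bar{\mathcal{Q}}_r$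 be the ranges of $Q_r$, $Q_r^{\mathrm T}$. For $r\ne s$ let $\mathcal{Q}^0_{rs}$, $\bar{\mathcal{Q}}^0_{rs}$ be the subspaces spanned by $\|f_{rs}\rangle\!\rangle$, $\|f^*_{rs}\rangle\!\rangle$, and let $\mathcal{Q}_{rs}$, $\bar{\mathcal{Q}}_{rs}$ be the ranges of $Q_r-\|f_{rs}\rangle\!\rangle\langle\!\langle f_{rs}\|$ and $Q_r^{\mathrm T}-\|f^*_{rs}\rangle\!\rangle\langle\!\langle f^*_{rs}\|$. The angle between a nonzero vector $\psi$ and a subspace $\mathcal{P}$ with orthogonal projection $P$ is $\cos^{-1}(\|P\psi\|/\|\psi\|)$. Two subspaces are uniformly inclined at angle $\theta$ if every nonzero vector of either one makes the angle $\theta$ with the other; if they are lines, we say simply that they are inclined at angle $\theta$. Then for each pair of distinct indices $r,s$ the matrices $Q_r$ and $Q_r^{\mathrm T}$ are orthogonal projections, and there are orthogonal decompositions $$\mathcal{Q}_r=\mathcal{Q}^0_{rs}\oplus\mathcal{Q}_{rs},\qquad \bar{\mathcal{Q}}_r=\bar{\mathcal{Q}}^0_{rs}\oplus\bar{\mathcal{Q}}_{rs},$$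 where $\mathcal{Q}^0_{rs}\perp\mathcal{Q}_{rs}$, $\bar{\mathcal{Q}}^0_{rs}\perp\bar{\mathcal{Q}}_{rs}$, $\dim\mathcal{Q}^0_{rs}=\dim\bar{\mathcal{Q}}^0_{rs}=1$ and $\dim\mathcal{Q}_{rs}=\dim\bar{\mathcal{Q}}_{rs}=d-2$. Moreover: (a) (1) $\mathcal{Q}^0_{rs}\perp\mathcal{Q}_{sr}$ and $\mathcal{Q}_{rs}\perp\mathcal{Q}^0_{sr}$. (2) $\mathcal{Q}^0_{rs}$ and $\mathcal{Q}^0_{sr}$ are inclined at angle $\cos^{-1}\bigl(\frac{1}{d+1}\bigr)$. (3) $\mathcal{Q}_{rs}$ and $\mathcal{Q}_{sr}$ are uniformly inclined at angle $\cos^{-1}\bigl(\frac{1}{\sqrt{d+1}}\bigr)$. (b) (1) $\bar{\mathcal{Q}}^0_{rs}\perp\bar{\mathcal{Q}}_{sr}$ and $\bar{\mathcal{Q}}_{rs}\perp\bar{\mathcal{Q}}^0_{sr}$. (2) $\bar{\mathcal{Q}}^0_{rs}$ and $\bar{\mathcal{Q}}^0_{sr}$ are inclined at angle $\cos^{-1}\bigl(\frac{1}{d+1}\bigr)$.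 (3) $\bar{\mathcal{Q}}_{rs}$ and $\bar{\mathcal{Q}}_{sr}$ are uniformly inclined at angle $\cos^{-1}\bigl(\frac{1}{\sqrt{d+1}}\bigr)$. (c) (1) $\mathcal{Q}^0_{rs}\perp\bar{\mathcal{Q}}_{sr}$, $\mathcal{Q}_{rs}\perp\bar{\mathcal{Q}}^0_{sr}$ and $\mathcal{Q}_{rs}\perp\bar{\mathcal{Q}}_{sr}$. (2) $\mathcal{Q}^0_{rs}$ and $\bar{\mathcal{Q}}^0_{sr}$ are inclined at angle $\cos^{-1}\bigl(\frac{d}{d+1}\bigr)$. -/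

import Mathlib

noncomputable section

/-- A SIC set in dimension `d`: a family of `d ^ 2` rank-one orthogonal projections on `ℂ ^ d`
with `Tr (Π r * Π s) = 1` if `r = s` and `= 1 / (d + 1)` otherwise. -/
structure IsSICSet (d : ℕ) (P : Fin (d ^ 2) → Matrix (Fin d) (Fin d) ℂ) : Prop where
  isStarProjection : ∀ r, IsStarProjection (P r)
  rank_eq_one : ∀ r, (P r).rank = 1
  trace_mul : ∀ r s, (P r * P s).trace = if r = s then 1 else 1 / ((d : ℂ) + 1)

namespace SIC

/-- The Hilbert space `ℂ ^ (d ^ 2)` with its standard inner product. -/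
abbrev H (d : ℕ) : Type := EuclideanSpace ℂ (Fin (d ^ 2))

/-- The matrix of triple products, `(T r) s t = Tr (Π r * Π s * Π t)`. -/
def T {d : ℕ} (P : Fin (d ^ 2) → Matrix (Fin d) (Fin d) ℂ) (r : Fin (d ^ 2)) :
    Matrix (Fin (d ^ 2)) (Fin (d ^ 2)) ℂ :=
  Matrix.of fun s t => (P r * P s * P t).trace

/-- `K r s = √((d * δ r s + 1) / (d + 1))`. -/
def K (d : ℕ) (r s : Fin (d ^ 2)) : ℝ :=
  √(((d : ℝ) * (if r = s then 1 else 0) + 1) / ((d : ℝ) + 1))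

/-- The vector with components `(e r) s = √((d + 1) / (2 * d)) * (K r s) ^ 2`. -/
def e (d : ℕ) (r : Fin (d ^ 2)) : Fin (d ^ 2) → ℂ :=
  fun s => ((√(((d : ℝ) + 1) / (2 * (d : ℝ))) * K d r s ^ 2 : ℝ) : ℂ)

/-- `Q r = ((d + 1) / d) * T r - 2 * |e r⟩⟨e r|`. -/
def Q {d : ℕ} (P : Fin (d ^ 2) → Matrix (Fin d) (Fin d) ℂ) (r : Fin (d ^ 2)) :
    Matrix (Fin (d ^ 2)) (Fin (d ^ 2)) ℂ :=
  (((d : ℂ) + 1) / (d : ℂ)) • T P r - (2 : ℂ) • Matrix.vecMulVec (e d r) (star (e d r))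

/-- `f r s = i √(d + 1) * Q r |s⟩`, where `|s⟩` is the `s`-th standard basis vector. -/
def f {d : ℕ} (P : Fin (d ^ 2) → Matrix (Fin d) (Fin d) ℂ) (r s : Fin (d ^ 2)) :
    Fin (d ^ 2) → ℂ :=
  (Complex.I * ((√((d : ℝ) + 1) : ℝ) : ℂ)) • (Q P r).mulVec (Pi.single s 1)

/-- `f* r s = - i √(d + 1) * (Q r)ᵀ |s⟩`. -/
def fStar {d : ℕ} (P : Fin (d ^ 2) → Matrix (Fin d) (Fin d) ℂ) (r s : Fin (d ^ 2)) :
    Fin (d ^ 2) → ℂ :=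
  (-(Complex.I * ((√((d : ℝ) + 1) : ℝ) : ℂ))) • (Q P r).transpose.mulVec (Pi.single s 1)

/-- The range of a matrix, as a subspace of `ℂ ^ (d ^ 2)`. -/
def matRange {d : ℕ} (A : Matrix (Fin (d ^ 2)) (Fin (d ^ 2)) ℂ) : Submodule ℂ (H d) :=
  LinearMap.range (Matrix.toEuclideanLin A)

/-- The range of `Q r`. -/
def SQ {d : ℕ} (P : Fin (d ^ 2) → Matrix (Fin d) (Fin d) ℂ) (r : Fin (d ^ 2)) :
    Submodule ℂ (H d) :=
  matRange (Q P r)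

/-- The range of `(Q r)ᵀ`. -/
def SQbar {d : ℕ} (P : Fin (d ^ 2) → Matrix (Fin d) (Fin d) ℂ) (r : Fin (d ^ 2)) :
    Submodule ℂ (H d) :=
  matRange (Q P r).transpose

/-- The subspace spanned by `f r s`. -/
def lineQ {d : ℕ} (P : Fin (d ^ 2) → Matrix (Fin d) (Fin d) ℂ) (r s : Fin (d ^ 2)) :
    Submodule ℂ (H d) :=
  Submodule.span ℂ {WithLp.toLp 2 (f P r s)}

/-- The subspace spanned by `f* r s`. -/
def lineQbar {d : ℕ} (P : Fin (d ^ 2) → Matrix (Fin d) (Fin d) ℂ) (r s : Fin (d ^ 2)) :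
    Submodule ℂ (H d) :=
  Submodule.span ℂ {WithLp.toLp 2 (fStar P r s)}

/-- The range of `Q r - |f r s⟩⟨f r s|`. -/
def restQ {d : ℕ} (P : Fin (d ^ 2) → Matrix (Fin d) (Fin d) ℂ) (r s : Fin (d ^ 2)) :
    Submodule ℂ (H d) :=
  matRange (Q P r - Matrix.vecMulVec (f P r s) (star (f P r s)))

/-- The range of `(Q r)ᵀ - |f* r s⟩⟨f* r s|`. -/
def restQbar {d : ℕ} (P : Fin (d ^ 2) → Matrix (Fin d) (Fin d) ℂ) (r s : Fin (d ^ 2)) :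
    Submodule ℂ (H d) :=
  matRange ((Q P r).transpose - Matrix.vecMulVec (fStar P r s) (star (fStar P r s)))

/-- The angle between a (nonzero) vector `ψ` and a subspace `U`:
the inverse cosine of `‖proj_U ψ‖ / ‖ψ‖`. -/
def angle {d : ℕ} (ψ : H d) (U : Submodule ℂ (H d)) : ℝ :=
  Real.arccos (‖U.starProjection ψ‖ / ‖ψ‖)

/-- `U` is uniformly inclined to `V` at angle `θ`: every nonzero vector of `U` makes the angle `θ`
with `V`. -/
def UniformlyInclinedTo {d : ℕ} (U V : Submodule ℂ (H d)) (θ : ℝ) : Prop :=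
  ∀ ψ ∈ U, ψ ≠ 0 → angle ψ V = θ

/-- `U` and `V` are uniformly inclined at angle `θ` (each of them to the other). For two lines this
says that the angle between them is `θ`. -/
def Inclined {d : ℕ} (U V : Submodule ℂ (H d)) (θ : ℝ) : Prop :=
  UniformlyInclinedTo U V θ ∧ UniformlyInclinedTo V U θ

end SIC

end

open scoped InnerProductSpace

namespace SIC

/-! Write `Π r = |ψ r⟩⟨ψ r|`. The SIC projections are a basis of the matrix space and satisfy the
2-design identity. Let `V r` (`frameMap`) send `x` to the vector with entries `√((d+1)/d) ⟪ψ r, ψ t⟫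
⟪ψ t, x⟫`. The design identity gives `⟪V r x, V s y⟫ = ⟪x, ψ r⟫⟪ψ s, y⟫ + ⟪x, y⟫⟪ψ s, ψ r⟫`
(`inner_frameMap_frameMap`), so `V r` is isometric on the complement of `ψ r`, and `Q r = V r (1 -
|ψ r⟩⟨ψ r|) (V r)†` is the projection onto the image of that complement (`toEuclideanLin_Q`). There
`f r s` spans the image of the component of `ψ s` orthogonal to `ψ r`, and `restQ r s` is the image
of the vectors orthogonal to both (`mem_restQ_iff`). Every relation between `Q r` and `Q s` is then
read off from the formula.

Transposing `Q` amounts to conjugating the SIC, so (b) is (a) for the conjugate SIC. For (c),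
`inner_frameMap_frameMap_conj` has no term `⟪x, y⟫`, which is why the two large subspaces become
orthogonal. -/

/-! ### Rank-one projections and vectors -/

/-- The rank-one matrix `|x⟩⟨x|`. -/
def rankOneProj {d : ℕ} (x : EuclideanSpace ℂ (Fin d)) : Matrix (Fin d) (Fin d) ℂ :=
  Matrix.vecMulVec x.ofLp (star x.ofLp)

/-- Unit vectors representing a SIC, together with the 2-design identity. -/
structure IsSICFrame {d : ℕ} (ψ : Fin (d ^ 2) → EuclideanSpace ℂ (Fin d)) : Prop where
  inner_self : ∀ r, ⟪ψ r, ψ r⟫_ℂ = 1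
  overlap : ∀ r s, r ≠ s → ⟪ψ r, ψ s⟫_ℂ * ⟪ψ s, ψ r⟫_ℂ = 1 / ((d : ℂ) + 1)
  design : ∀ a b c e, ∑ t, ⟪a, ψ t⟫_ℂ * ⟪ψ t, b⟫_ℂ * (⟪c, ψ t⟫_ℂ * ⟪ψ t, e⟫_ℂ) =
    (d : ℂ) / ((d : ℂ) + 1) * (⟪a, b⟫_ℂ * ⟪c, e⟫_ℂ + ⟪a, e⟫_ℂ * ⟪c, b⟫_ℂ)

lemma natCast_add_one_ne_zero (d : ℕ) : (d : ℂ) + 1 ≠ 0 := by exact_mod_cast d.succ_ne_zero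

/-- A rank-one orthogonal projection is `|x⟩⟨x|` for some vector `x`. -/
lemma exists_eq_rankOneProj {d : ℕ} {A : Matrix (Fin d) (Fin d) ℂ} (hA : IsStarProjection A)
    (hr : A.rank = 1) : ∃ x, A = rankOneProj x := by
  rw [Matrix.rank, finrank_eq_one_iff'] at hr
  obtain ⟨⟨v, w, hw⟩, hv0, hv⟩ := hr
  have hv0' : v ≠ 0 := fun h => hv0 (Subtype.ext h)
  have hherm : A.conjTranspose = A := hA.isSelfAdjoint
  have hidem : A * A = A := hA.isIdempotentElem
  have hAv : A.mulVec v = v := by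
    rw [← hw, Matrix.mulVecLin_apply, Matrix.mulVec_mulVec, hidem]
  have hcol : ∀ j, ∃ c : ℂ, c • v = A.mulVec (Pi.single j 1) := fun j => by
    obtain ⟨c, hc⟩ := hv ⟨A.mulVec (Pi.single j 1), _, rfl⟩
    exact ⟨c, congrArg Subtype.val hc⟩
  choose c hc using hcol
  have hAc : A = Matrix.vecMulVec v c := by
    ext i j
    have := congrFun (hc j) i
    simp only [Pi.smul_apply, smul_eq_mul, Matrix.mulVec_single_one, Matrix.col_apply] at this
    rw [Matrix.vecMulVec_apply, ← this, mul_comm]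
  have hvA : Matrix.vecMul (star v) A = star v := by
    rw [← hherm, ← Matrix.star_mulVec, hAv]
  -- With `A = v cᵀ`, the relation `v† A = v†` forces `c` to be a multiple of the conjugate of `v`;
  -- normalising `v` then gives `x`.
  have hsc : (star v ⬝ᵥ v) • c = star v := by
    rw [hAc, Matrix.vecMul_vecMulVec] at hvA
    exact hvA
  have hreal : star v ⬝ᵥ v = ((‖WithLp.toLp 2 v‖ : ℝ) : ℂ) ^ 2 := by
    have := inner_self_eq_norm_sq_to_K (𝕜 := ℂ) (WithLp.toLp 2 v)
    rw [EuclideanSpace.inner_toLp_toLp, dotProduct_comm] at this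
    exact this
  set n : ℝ := ‖WithLp.toLp 2 v‖
  have hn0 : (n : ℂ) ≠ 0 := Complex.ofReal_ne_zero.2 <|
    norm_ne_zero_iff.2 fun h => hv0' (congrArg WithLp.ofLp h)
  refine ⟨WithLp.toLp 2 ((n : ℂ)⁻¹ • v), ?_⟩
  have hc' : c = ((n : ℂ) ^ 2)⁻¹ • star v := by
    rw [← hsc, hreal, smul_smul, inv_mul_cancel₀ (pow_ne_zero _ hn0), one_smul]
  rw [hAc, rankOneProj, hc', star_smul, Matrix.smul_vecMulVec, Matrix.vecMulVec_smul,
    Matrix.vecMulVec_smul, smul_smul]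
  congr 1
  simp
  field_simp

lemma trace_rankOneProj_mul_rankOneProj {d : ℕ} (x y : EuclideanSpace ℂ (Fin d)) :
    (rankOneProj x * rankOneProj y).trace = ⟪x, y⟫_ℂ * ⟪y, x⟫_ℂ := by
  simp only [rankOneProj, Matrix.vecMulVec_mul_vecMulVec, Matrix.trace_vecMulVec,
    EuclideanSpace.inner_eq_star_dotProduct, dotProduct_smul, smul_eq_mul,
    dotProduct_comm (star x.ofLp)]

lemma trace_rankOneProj_mul_mul {d : ℕ} (x y z : EuclideanSpace ℂ (Fin d)) :
    (rankOneProj x * rankOneProj y * rankOneProj z).trace =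
      ⟪x, y⟫_ℂ * ⟪y, z⟫_ℂ * ⟪z, x⟫_ℂ := by
  simp only [rankOneProj, Matrix.vecMulVec_mul_vecMulVec, Matrix.trace_vecMulVec,
    EuclideanSpace.inner_eq_star_dotProduct, dotProduct_smul, smul_eq_mul,
    smul_dotProduct, dotProduct_comm (star _)]

/-! ### The 2-design property -/

section Design

variable {d : ℕ} {P : Fin (d ^ 2) → Matrix (Fin d) (Fin d) ℂ}

lemma trace_mul_sum_smul (hP : IsSICSet d P) (r : Fin (d ^ 2)) (g : Fin (d ^ 2) → ℂ) :
    (P r * ∑ t, g t • P t).trace = ((d : ℂ) * g r + ∑ t, g t) / ((d : ℂ) + 1) := by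
  have hd := natCast_add_one_ne_zero d
  have h : ∀ t, (P r * g t • P t).trace =
      (if r = t then (d : ℂ) / ((d : ℂ) + 1) * g t else 0) + g t / ((d : ℂ) + 1) := by
    intro t
    rw [Matrix.mul_smul, Matrix.trace_smul, hP.trace_mul, smul_eq_mul]
    split_ifs
    · field_simp
    · ring
  rw [Finset.mul_sum, Matrix.trace_sum, Finset.sum_congr rfl fun t _ => h t,
    Finset.sum_add_distrib, Finset.sum_ite_eq, if_pos (Finset.mem_univ _), ← Finset.sum_div]
  ring

/-- The Gram matrix `(d I + J) / (d + 1)`, with `J` the all-ones matrix, is nonsingular, so the `d ^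
2` projections are independent and their number equals the dimension. -/
lemma span_range_eq_top (hP : IsSICSet d P) : Submodule.span ℂ (Set.range P) = ⊤ := by
  refine LinearIndependent.span_eq_top_of_card_eq_finrank' (Fintype.linearIndependent_iff.2 ?_) ?_
  · intro g hg
    have h : ∀ r, (d : ℂ) * g r + ∑ t, g t = 0 := fun r => by
      have := trace_mul_sum_smul hP r g
      rw [hg, mul_zero, Matrix.trace_zero, eq_comm,
        div_eq_zero_iff, or_iff_left (natCast_add_one_ne_zero d)] at this
      exact this
    -- Summing `h r` over all `d ^ 2` indices isolates the total of `g`.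
    have hs : (d : ℂ) * (((d : ℂ) + 1) * ∑ t, g t) = 0 := by
      have := Finset.sum_congr (rfl : Finset.univ = Finset.univ) fun r _ => h r
      rw [Finset.sum_add_distrib, ← Finset.mul_sum, Finset.sum_const, Finset.sum_const_zero,
        Finset.card_univ, Fintype.card_fin, nsmul_eq_mul] at this
      push_cast at this
      linear_combination this
    intro r
    have hd : (d : ℂ) ≠ 0 := by
      rintro h0
      have : d = 0 := by exact_mod_cast h0
      subst this
      exact r.elim0
    have hG := (mul_eq_zero.1 ((mul_eq_zero.1 hs).resolve_left hd)).resolve_left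
      (natCast_add_one_ne_zero d)
    have := h r
    rw [hG, add_zero] at this
    exact (mul_eq_zero.1 this).resolve_left hd
  · simp [Module.finrank_matrix, sq]

lemma trace_eq_one (hP : IsSICSet d P) (r : Fin (d ^ 2)) : (P r).trace = 1 := by
  have h := hP.trace_mul r r
  rwa [(hP.isStarProjection r).isIdempotentElem.eq, if_pos rfl] at h

lemma sum_eq_natCast_smul_one (hP : IsSICSet d P) :
    ∑ t, P t = (d : ℂ) • (1 : Matrix (Fin d) (Fin d) ℂ) := by
  refine Matrix.ext_iff_trace_mul_left.2 fun A => ?_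
  have hA : A ∈ Submodule.span ℂ (Set.range P) := by rw [span_range_eq_top hP]; trivial
  -- The trace pairing is nondegenerate, so it suffices to test against the spanning `P r`, where
  -- both sides equal `d`.
  induction hA using Submodule.span_induction with
  | mem x hx =>
    obtain ⟨r, rfl⟩ := hx
    have := trace_mul_sum_smul hP r fun _ => 1
    simp only [one_smul, Finset.sum_const, Finset.card_univ, Fintype.card_fin, nsmul_eq_mul] at this
    rw [this, Matrix.mul_smul, Matrix.mul_one (P r), Matrix.trace_smul, trace_eq_one hP]
    have hd := natCast_add_one_ne_zero d
    push_cast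
    simp only [smul_eq_mul]
    field_simp
    ring
  | zero => simp
  | add x y _ _ hx hy => rw [add_mul, add_mul, Matrix.trace_add, Matrix.trace_add, hx, hy]
  | smul a x _ hx => rw [Matrix.smul_mul, Matrix.smul_mul, Matrix.trace_smul, Matrix.trace_smul, hx]

/-- The 2-design property of a SIC. -/
lemma sum_trace_mul_smul (hP : IsSICSet d P) (A : Matrix (Fin d) (Fin d) ℂ) :
    ∑ t, (P t * A).trace • P t = ((d : ℂ) / ((d : ℂ) + 1)) • (A + A.trace • 1) := by
  have hd := natCast_add_one_ne_zero d
  have hA : A ∈ Submodule.span ℂ (Set.range P) := by rw [span_range_eq_top hP]; trivial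
  induction hA using Submodule.span_induction with
  | mem x hx =>
    obtain ⟨r, rfl⟩ := hx
    have h : ∀ t, (P t * P r).trace • P t =
        (if t = r then ((d : ℂ) / ((d : ℂ) + 1)) • P t else 0) + (1 / ((d : ℂ) + 1)) • P t := by
      intro t
      rw [hP.trace_mul]
      split_ifs
      · rw [← add_smul]
        congr 1
        field_simp
      · rw [zero_add]
    rw [Finset.sum_congr rfl fun t _ => h t, Finset.sum_add_distrib, Finset.sum_ite_eq',
      if_pos (Finset.mem_univ _), ← Finset.smul_sum, sum_eq_natCast_smul_one hP, trace_eq_one hP,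
      smul_smul, smul_add, one_smul]
    congr 2
    ring
  | zero => simp
  | add x y _ _ hx hy =>
    simp only [mul_add, Matrix.trace_add, add_smul, Finset.sum_add_distrib, hx, hy, smul_add]
    abel
  | smul a x _ hx =>
    simp only [Matrix.mul_smul, Matrix.trace_smul, smul_assoc, ← Finset.smul_sum, hx]
    rw [smul_comm, ← smul_add]

theorem IsSICFrame.of_isSICSet {ψ : Fin (d ^ 2) → EuclideanSpace ℂ (Fin d)}
    (hP : IsSICSet d fun r => rankOneProj (ψ r)) : IsSICFrame ψ where
  inner_self r := by
    rw [← trace_eq_one hP r, rankOneProj, Matrix.trace_vecMulVec]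
    rfl
  overlap r s hrs := by
    rw [← trace_rankOneProj_mul_rankOneProj, hP.trace_mul r s, if_neg hrs]
  design a b c e := by
    -- The matrix element between `a` and `b` of the design identity at `A = |e⟩⟨c|`.
    have h := congrArg (fun M : Matrix (Fin d) (Fin d) ℂ => M.mulVec b.ofLp ⬝ᵥ star a.ofLp)
      (sum_trace_mul_smul hP (Matrix.vecMulVec e.ofLp (star c.ofLp)))
    simp only [Matrix.sum_mulVec, sum_dotProduct, Matrix.smul_mulVec, smul_dotProduct,
      rankOneProj, Matrix.vecMulVec_mul_vecMulVec, Matrix.trace_vecMulVec, Matrix.trace_smul,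
      Matrix.vecMulVec_mulVec, op_smul_eq_smul, Matrix.add_mulVec, add_dotProduct,
      Matrix.one_mulVec, smul_eq_mul, dotProduct_comm (star _) _, Matrix.vecMulVec_smul] at h
    simp only [EuclideanSpace.inner_eq_star_dotProduct]
    refine Eq.trans (Finset.sum_congr rfl fun t _ => ?_) (h.trans ?_) <;> ring

/-! ### Conjugate SIC -/

/-- The complex conjugate of a vector. -/
def conjVec {ι : Type*} (x : EuclideanSpace ℂ ι) : EuclideanSpace ℂ ι :=
  WithLp.toLp 2 (star x.ofLp)

lemma inner_conjVec_conjVec {ι : Type*} [Fintype ι] (x y : EuclideanSpace ℂ ι) :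
    ⟪conjVec x, conjVec y⟫_ℂ = ⟪y, x⟫_ℂ := by
  simp only [conjVec, EuclideanSpace.inner_eq_star_dotProduct, star_star, dotProduct_comm]

lemma conjVec_conjVec {ι : Type*} (x : EuclideanSpace ℂ ι) : conjVec (conjVec x) = x := by
  simp [conjVec]

lemma IsSICFrame.conj {ψ : Fin (d ^ 2) → EuclideanSpace ℂ (Fin d)} (h : IsSICFrame ψ) :
    IsSICFrame fun r => conjVec (ψ r) where
  inner_self r := by rw [inner_conjVec_conjVec, h.inner_self]
  overlap r s hrs := by rw [inner_conjVec_conjVec, inner_conjVec_conjVec, h.overlap s r hrs.symm]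
  design a b c e := by
    have key : ∀ a b c e, ∑ t, ⟪conjVec a, conjVec (ψ t)⟫_ℂ * ⟪conjVec (ψ t), conjVec b⟫_ℂ *
        (⟪conjVec c, conjVec (ψ t)⟫_ℂ * ⟪conjVec (ψ t), conjVec e⟫_ℂ) = (d : ℂ) / ((d : ℂ) + 1) *
          (⟪conjVec a, conjVec b⟫_ℂ * ⟪conjVec c, conjVec e⟫_ℂ +
            ⟪conjVec a, conjVec e⟫_ℂ * ⟪conjVec c, conjVec b⟫_ℂ) := fun a b c e => by
      simp only [inner_conjVec_conjVec]
      refine Eq.trans (Finset.sum_congr rfl fun t _ => ?_) ((h.design b a e c).trans ?_) <;> ring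
    simpa only [conjVec_conjVec] using key (conjVec a) (conjVec b) (conjVec c) (conjVec e)

end Design

/-! ### The frame map and its inner products -/

section FrameMap

variable {d : ℕ} (ψ : Fin (d ^ 2) → EuclideanSpace ℂ (Fin d))

/-- The normalisation constant `√((d + 1) / d)`. -/
noncomputable def frameConst (d : ℕ) : ℂ := ((√(((d : ℝ) + 1) / (d : ℝ)) : ℝ) : ℂ)

lemma frameConst_mul_self (d : ℕ) : frameConst d * frameConst d = ((d : ℂ) + 1) / (d : ℂ) := by
  rw [frameConst, ← Complex.ofReal_mul, Real.mul_self_sqrt (by positivity)]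
  push_cast
  rfl

lemma conj_frameConst (d : ℕ) : (starRingEnd ℂ) (frameConst d) = frameConst d :=
  Complex.conj_ofReal _

/-- The linear map `x ↦ (√((d + 1) / d) * ⟪ψ r, ψ t⟫ * ⟪ψ t, x⟫)ₜ`, isometric on the orthogonal
complement of `ψ r`. -/
noncomputable def frameMap (r : Fin (d ^ 2)) : EuclideanSpace ℂ (Fin d) →ₗ[ℂ] H d where
  toFun x := WithLp.toLp 2 fun t => frameConst d * (⟪ψ r, ψ t⟫_ℂ * ⟪ψ t, x⟫_ℂ)
  map_add' x y := by
    ext t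
    simp only [inner_add_right, PiLp.add_apply]
    ring
  map_smul' a x := by
    ext t
    simp only [inner_smul_right, PiLp.smul_apply, smul_eq_mul, RingHom.id_apply]
    ring

lemma frameMap_apply (r t : Fin (d ^ 2)) (x : EuclideanSpace ℂ (Fin d)) :
    frameMap ψ r x t = frameConst d * (⟪ψ r, ψ t⟫_ℂ * ⟪ψ t, x⟫_ℂ) := rfl

/-- The adjoint of `frameMap`. -/
noncomputable def frameAdj (r : Fin (d ^ 2)) (z : H d) : EuclideanSpace ℂ (Fin d) :=
  ∑ t, (frameConst d * (⟪ψ t, ψ r⟫_ℂ * z t)) • ψ t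

lemma inner_frameMap_left (r : Fin (d ^ 2)) (x : EuclideanSpace ℂ (Fin d)) (z : H d) :
    ⟪frameMap ψ r x, z⟫_ℂ = ⟪x, frameAdj ψ r z⟫_ℂ := by
  rw [frameAdj, inner_sum, PiLp.inner_apply]
  refine Finset.sum_congr rfl fun t _ => ?_
  rw [frameMap_apply, inner_smul_right, RCLike.inner_apply, map_mul, map_mul, conj_frameConst,
    inner_conj_symm, inner_conj_symm]
  ring

/-- The component of `x` orthogonal to the unit vector `y`. -/
noncomputable def perp (y x : EuclideanSpace ℂ (Fin d)) : EuclideanSpace ℂ (Fin d) := x - ⟪y, x⟫_ℂ • y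

variable {ψ}

lemma inner_perp_self {y : EuclideanSpace ℂ (Fin d)} (hy : ⟪y, y⟫_ℂ = 1)
    (x : EuclideanSpace ℂ (Fin d)) : ⟪y, perp y x⟫_ℂ = 0 := by
  rw [perp, inner_sub_right, inner_smul_right, hy, mul_one, sub_self]

lemma inner_perp_left {y z : EuclideanSpace ℂ (Fin d)} (h : ⟪y, z⟫_ℂ = 0)
    (x : EuclideanSpace ℂ (Fin d)) : ⟪perp y x, z⟫_ℂ = ⟪x, z⟫_ℂ := by
  rw [perp, inner_sub_left, inner_smul_left, h, mul_zero, sub_zero]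

lemma perp_of_inner_eq_zero {y x : EuclideanSpace ℂ (Fin d)} (h : ⟪y, x⟫_ℂ = 0) :
    perp y x = x := by
  rw [perp, h, zero_smul, sub_zero]

lemma natCast_ne_zero_of_fin_sq (r : Fin (d ^ 2)) : (d : ℂ) ≠ 0 := by
  intro h0
  have : d = 0 := by exact_mod_cast h0
  subst this
  exact r.elim0

lemma inner_frameMap_frameMap (h : IsSICFrame ψ) (r s : Fin (d ^ 2))
    (x y : EuclideanSpace ℂ (Fin d)) :
    ⟪frameMap ψ r x, frameMap ψ s y⟫_ℂ =
      ⟪x, ψ r⟫_ℂ * ⟪ψ s, y⟫_ℂ + ⟪x, y⟫_ℂ * ⟪ψ s, ψ r⟫_ℂ := by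
  have hd := natCast_ne_zero_of_fin_sq r
  have hd' := natCast_add_one_ne_zero d
  have key := congrArg (frameConst d * frameConst d * ·) (h.design x (ψ r) (ψ s) y)
  simp only [frameConst_mul_self, ← mul_assoc, div_mul_div_cancel₀ hd, div_self hd', one_mul]
    at key
  rw [← key, ← frameConst_mul_self, PiLp.inner_apply, Finset.mul_sum]
  refine Finset.sum_congr rfl fun t _ => ?_
  rw [frameMap_apply, frameMap_apply, RCLike.inner_apply, map_mul, map_mul, conj_frameConst,
    inner_conj_symm, inner_conj_symm]
  ring

/-- Conjugation swaps bra and ket in the second factor, so the design identity is applied with `y`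
and `ψ s` interchanged. -/
lemma inner_frameMap_frameMap_conj (h : IsSICFrame ψ) (r s : Fin (d ^ 2))
    (x y : EuclideanSpace ℂ (Fin d)) :
    ⟪frameMap ψ r x, frameMap (fun t => conjVec (ψ t)) s (conjVec y)⟫_ℂ =
      ⟪x, ψ r⟫_ℂ * ⟪y, ψ s⟫_ℂ + ⟪x, ψ s⟫_ℂ * ⟪y, ψ r⟫_ℂ := by
  have hd := natCast_ne_zero_of_fin_sq r
  have hd' := natCast_add_one_ne_zero d
  have key := congrArg (frameConst d * frameConst d * ·) (h.design x (ψ r) y (ψ s))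
  simp only [frameConst_mul_self, ← mul_assoc, div_mul_div_cancel₀ hd, div_self hd', one_mul]
    at key
  rw [← key, ← frameConst_mul_self, PiLp.inner_apply, Finset.mul_sum]
  refine Finset.sum_congr rfl fun t _ => ?_
  rw [frameMap_apply, frameMap_apply, RCLike.inner_apply, map_mul, map_mul, conj_frameConst,
    inner_conj_symm, inner_conj_symm, inner_conjVec_conjVec, inner_conjVec_conjVec]
  ring

lemma inner_frameMap_self (h : IsSICFrame ψ) {r : Fin (d ^ 2)} {x : EuclideanSpace ℂ (Fin d)}
    (y : EuclideanSpace ℂ (Fin d)) (hx : ⟪ψ r, x⟫_ℂ = 0) :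
    ⟪frameMap ψ r x, frameMap ψ r y⟫_ℂ = ⟪x, y⟫_ℂ := by
  rw [inner_frameMap_frameMap h, inner_eq_zero_symm.1 hx, h.inner_self, zero_mul, zero_add,
    mul_one]

lemma frameAdj_frameMap (h : IsSICFrame ψ) {r : Fin (d ^ 2)} {x : EuclideanSpace ℂ (Fin d)}
    (hx : ⟪ψ r, x⟫_ℂ = 0) : frameAdj ψ r (frameMap ψ r x) = x := by
  refine ext_inner_left ℂ fun y => ?_
  rw [← inner_frameMap_left, inner_frameMap_frameMap h, hx, h.inner_self, mul_zero, zero_add,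
    mul_one]

/-! ### `Q r` and its subspaces through the frame map -/

lemma K_sq (h : IsSICFrame ψ) (r s : Fin (d ^ 2)) :
    ((K d r s ^ 2 : ℝ) : ℂ) = ⟪ψ r, ψ s⟫_ℂ * ⟪ψ s, ψ r⟫_ℂ := by
  have hd := natCast_add_one_ne_zero d
  rw [K, Real.sq_sqrt (by positivity)]
  split_ifs with hrs
  · subst hrs
    rw [h.inner_self]
    push_cast
    field_simp
  · rw [h.overlap r s hrs]
    push_cast
    ring

/-- The term `2 |e r⟩⟨e r|` has the same prefactor `(d + 1) / d` as the triple products, and removes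
exactly the `ψ r` component of `ψ t`. -/
lemma Q_apply (h : IsSICFrame ψ) (r u t : Fin (d ^ 2)) :
    Q (fun r => rankOneProj (ψ r)) r u t =
      frameConst d * (⟪ψ r, ψ u⟫_ℂ *
        (frameConst d * (⟪ψ t, ψ r⟫_ℂ * ⟪ψ u, perp (ψ r) (ψ t)⟫_ℂ))) := by
  have hd := natCast_ne_zero_of_fin_sq r
  have hc : (2 : ℂ) * (e d r u * star (e d r t)) =
      ((d : ℂ) + 1) / (d : ℂ) *
        (⟪ψ r, ψ u⟫_ℂ * ⟪ψ u, ψ r⟫_ℂ * (⟪ψ r, ψ t⟫_ℂ * ⟪ψ t, ψ r⟫_ℂ)) := by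
    rw [← K_sq h, ← K_sq h, e, e]
    have : (√(((d : ℝ) + 1) / (2 * (d : ℝ))) : ℂ) * (√(((d : ℝ) + 1) / (2 * (d : ℝ))) : ℂ) =
        ((d : ℂ) + 1) / (2 * (d : ℂ)) := by
      rw [← Complex.ofReal_mul, Real.mul_self_sqrt (by positivity)]
      push_cast
      rfl
    simp only [Complex.ofReal_mul, star_mul', Complex.star_def, Complex.conj_ofReal]
    linear_combination (2 * ((K d r u ^ 2 : ℝ) : ℂ) * ((K d r t ^ 2 : ℝ) : ℂ)) * this
  rw [Q, Matrix.sub_apply, Matrix.smul_apply, Matrix.smul_apply, Matrix.vecMulVec_apply,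
    smul_eq_mul, smul_eq_mul, Pi.star_apply, hc, T, Matrix.of_apply, trace_rankOneProj_mul_mul,
    ← frameConst_mul_self, perp, inner_sub_right, inner_smul_right]
  ring

lemma toEuclideanLin_Q (h : IsSICFrame ψ) (r : Fin (d ^ 2)) (z : H d) :
    Matrix.toEuclideanLin (Q (fun r => rankOneProj (ψ r)) r) z =
      frameMap ψ r (perp (ψ r) (frameAdj ψ r z)) := by
  ext u
  rw [Matrix.toLpLin_apply, frameMap_apply]
  have hp : perp (ψ r) (frameAdj ψ r z) =
      ∑ t, (frameConst d * (⟪ψ t, ψ r⟫_ℂ * z t)) • perp (ψ r) (ψ t) := by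
    simp only [perp, frameAdj, inner_sum, inner_smul_right, Finset.sum_smul, smul_sub,
      Finset.sum_sub_distrib, smul_smul]
  simp only [hp, inner_sum, inner_smul_right, Finset.mul_sum, Matrix.mulVec, dotProduct, Q_apply h]
  refine Finset.sum_congr rfl fun t _ => ?_
  ring

lemma isStarProjection_Q (h : IsSICFrame ψ) (r : Fin (d ^ 2)) :
    IsStarProjection (Q (fun r => rankOneProj (ψ r)) r) where
  isIdempotentElem := by
    refine Matrix.toEuclideanLin.injective (LinearMap.ext fun z => ?_)
    rw [Matrix.toLpLin_mul_same, LinearMap.comp_apply, toEuclideanLin_Q h, toEuclideanLin_Q h,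
      frameAdj_frameMap h (inner_perp_self (h.inner_self r) _),
      perp_of_inner_eq_zero (inner_perp_self (h.inner_self r) _)]
  isSelfAdjoint := by
    ext u t
    rw [Matrix.star_apply, Q_apply h, Q_apply h]
    simp only [perp, inner_sub_right, inner_smul_right, Complex.star_def, map_mul, map_sub,
      conj_frameConst, inner_conj_symm]
    ring

lemma mem_SQ_iff (h : IsSICFrame ψ) (r : Fin (d ^ 2)) (z : H d) :
    z ∈ SQ (fun r => rankOneProj (ψ r)) r ↔ ∃ x, ⟪ψ r, x⟫_ℂ = 0 ∧ frameMap ψ r x = z := by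
  constructor
  · rintro ⟨w, rfl⟩
    exact ⟨_, inner_perp_self (h.inner_self r) _, (toEuclideanLin_Q h r w).symm⟩
  · rintro ⟨x, hx, rfl⟩
    refine ⟨frameMap ψ r x, ?_⟩
    rw [toEuclideanLin_Q h, frameAdj_frameMap h hx, perp_of_inner_eq_zero hx]

/-- The scalar relating `f r s` to the image of the component of `ψ s` orthogonal to `ψ r`. -/
noncomputable def fCoeff (ψ : Fin (d ^ 2) → EuclideanSpace ℂ (Fin d)) (r s : Fin (d ^ 2)) : ℂ :=
  Complex.I * ((√((d : ℝ) + 1) : ℝ) : ℂ) * (frameConst d * ⟪ψ s, ψ r⟫_ℂ)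

/-- The vector spanning `lineQ r s`. -/
noncomputable def lineVec (ψ : Fin (d ^ 2) → EuclideanSpace ℂ (Fin d)) (r s : Fin (d ^ 2)) : H d :=
  frameMap ψ r (perp (ψ r) (ψ s))

lemma toLp_f (h : IsSICFrame ψ) (r s : Fin (d ^ 2)) :
    WithLp.toLp 2 (f (fun r => rankOneProj (ψ r)) r s) = fCoeff ψ r s • lineVec ψ r s := by
  have hs : frameAdj ψ r (WithLp.toLp 2 (Pi.single s 1)) = (frameConst d * ⟪ψ s, ψ r⟫_ℂ) • ψ s := by
    rw [frameAdj, Finset.sum_eq_single s]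
    · simp
    · intro t _ ht
      simp [Pi.single_eq_of_ne ht]
    · simp
  have hp : ∀ a : ℂ, perp (ψ r) (a • ψ s) = a • perp (ψ r) (ψ s) := fun a => by
    rw [perp, perp, inner_smul_right, smul_sub, smul_smul]
  rw [f, WithLp.toLp_smul, ← Matrix.toLpLin_apply 2 2 _ (WithLp.toLp 2 (Pi.single s 1)), toEuclideanLin_Q h, hs,
    hp, map_smul, smul_smul]
  rfl

section Pair

variable {r s : Fin (d ^ 2)}

/-- This is the reciprocal of the squared norm of `lineVec`, so `f r s` is a unit vector and `|f r
s⟩⟨f r s|` a projection. -/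
lemma fCoeff_mul_conj (h : IsSICFrame ψ) (hrs : r ≠ s) :
    fCoeff ψ r s * (starRingEnd ℂ) (fCoeff ψ r s) = ((d : ℂ) + 1) / (d : ℂ) := by
  have hd := natCast_add_one_ne_zero d
  have hsq : ((√((d : ℝ) + 1) : ℝ) : ℂ) * ((√((d : ℝ) + 1) : ℝ) : ℂ) = (d : ℂ) + 1 := by
    rw [← Complex.ofReal_mul, Real.mul_self_sqrt (by positivity)]
    push_cast
    rfl
  simp only [fCoeff, map_mul, Complex.conj_I, Complex.conj_ofReal, conj_frameConst,
    inner_conj_symm]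
  calc _ = -(Complex.I * Complex.I) * (((√((d : ℝ) + 1) : ℝ) : ℂ) * ((√((d : ℝ) + 1) : ℝ) : ℂ)) *
        (frameConst d * frameConst d) * (⟪ψ r, ψ s⟫_ℂ * ⟪ψ s, ψ r⟫_ℂ) := by ring
    _ = _ := by
      rw [Complex.I_mul_I, hsq, frameConst_mul_self, h.overlap r s hrs]
      field_simp

lemma fCoeff_ne_zero (h : IsSICFrame ψ) (hrs : r ≠ s) : fCoeff ψ r s ≠ 0 := by
  intro h0
  have := fCoeff_mul_conj h hrs
  rw [h0, zero_mul, eq_comm, div_eq_zero_iff] at this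
  exact this.elim (natCast_add_one_ne_zero d) (natCast_ne_zero_of_fin_sq r)

lemma lineQ_eq (h : IsSICFrame ψ) (hrs : r ≠ s) :
    lineQ (fun r => rankOneProj (ψ r)) r s = Submodule.span ℂ {lineVec ψ r s} := by
  rw [lineQ, toLp_f h, Submodule.span_singleton_smul_eq (fCoeff_ne_zero h hrs).isUnit]

lemma inner_perp_right_overlap (h : IsSICFrame ψ) (hrs : r ≠ s) :
    ⟪ψ s, perp (ψ r) (ψ s)⟫_ℂ = (d : ℂ) / ((d : ℂ) + 1) := by
  have hd := natCast_add_one_ne_zero d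
  rw [perp, inner_sub_right, inner_smul_right, h.inner_self, h.overlap r s hrs]
  field_simp
  ring

lemma inner_lineVec_self (h : IsSICFrame ψ) (hrs : r ≠ s) :
    ⟪lineVec ψ r s, lineVec ψ r s⟫_ℂ = (d : ℂ) / ((d : ℂ) + 1) := by
  have h0 := inner_perp_self (h.inner_self r) (ψ s)
  rw [lineVec, inner_frameMap_self h _ h0, inner_perp_left h0, inner_perp_right_overlap h hrs]

lemma mem_restQ_iff (h : IsSICFrame ψ) (hrs : r ≠ s) (z : H d) :
    z ∈ restQ (fun r => rankOneProj (ψ r)) r s ↔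
      ∃ x, ⟪ψ r, x⟫_ℂ = 0 ∧ ⟪ψ s, x⟫_ℂ = 0 ∧ frameMap ψ r x = z := by
  have hd := natCast_ne_zero_of_fin_sq r
  have hd' := natCast_add_one_ne_zero d
  have hn := inner_perp_self (h.inner_self r) (ψ s)
  -- Pulled back through the frame map, subtracting `|f⟩⟨f|` removes the component along `perp (ψ r)
  -- (ψ s)`.
  have hmat : ∀ w, Matrix.toEuclideanLin (Q (fun r => rankOneProj (ψ r)) r -
        Matrix.vecMulVec (f (fun r => rankOneProj (ψ r)) r s)
          (star (f (fun r => rankOneProj (ψ r)) r s))) w =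
      frameMap ψ r (perp (ψ r) (frameAdj ψ r w) -
        (((d : ℂ) + 1) / (d : ℂ) * ⟪perp (ψ r) (ψ s), frameAdj ψ r w⟫_ℂ) •
          perp (ψ r) (ψ s)) := by
    intro w
    have hf : Matrix.toEuclideanLin (Matrix.vecMulVec (f (fun r => rankOneProj (ψ r)) r s)
          (star (f (fun r => rankOneProj (ψ r)) r s))) w =
        ⟪WithLp.toLp 2 (f (fun r => rankOneProj (ψ r)) r s), w⟫_ℂ •
          WithLp.toLp 2 (f (fun r => rankOneProj (ψ r)) r s) := by
      rw [Matrix.toLpLin_apply, Matrix.vecMulVec_mulVec, op_smul_eq_smul, dotProduct_comm]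
      rfl
    rw [map_sub, LinearMap.sub_apply, toEuclideanLin_Q h, hf, toLp_f h, inner_smul_left, smul_smul,
      mul_right_comm, mul_comm _ (fCoeff ψ r s), fCoeff_mul_conj h hrs, lineVec,
      inner_frameMap_left, map_sub, map_smul]
  constructor
  · rintro ⟨w, rfl⟩
    refine ⟨_, ?_, ?_, (hmat w).symm⟩
    · rw [inner_sub_right, inner_smul_right, hn, inner_perp_self (h.inner_self r), mul_zero,
        sub_zero]
    · have hw := inner_perp_self (h.inner_self r) (frameAdj ψ r w)
      have hsym : ⟪perp (ψ r) (ψ s), frameAdj ψ r w⟫_ℂ =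
          ⟪ψ s, perp (ψ r) (frameAdj ψ r w)⟫_ℂ := by
        rw [← inner_perp_left hw (ψ s), ← inner_conj_symm, ← inner_perp_left hn, inner_conj_symm]
      rw [inner_sub_right, inner_smul_right, inner_perp_right_overlap h hrs, hsym]
      field_simp
      ring
  · rintro ⟨x, hx, hx', rfl⟩
    refine ⟨frameMap ψ r x, ?_⟩
    rw [hmat, frameAdj_frameMap h hx, perp_of_inner_eq_zero hx, inner_perp_left hx, hx', mul_zero,
      zero_smul, sub_zero]

end Pair

end FrameMap

variable {d : ℕ}

/-! ### Transposition as conjugation of the SIC -/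

section Transpose

variable (P : Fin (d ^ 2) → Matrix (Fin d) (Fin d) ℂ)

lemma Q_transpose (r : Fin (d ^ 2)) : Q (fun t => (P t).transpose) r = (Q P r).transpose := by
  ext u t
  -- Transposition reverses the triple product; cyclicity of the trace turns this into a swap of `u`
  -- and `t`.
  have hT : ((P r).transpose * (P u).transpose * (P t).transpose).trace =
      (P r * P t * P u).trace := by
    rw [← Matrix.transpose_mul, ← Matrix.transpose_mul, Matrix.trace_transpose,
      ← Matrix.mul_assoc, Matrix.trace_mul_cycle]
  simp only [Q, T, Matrix.sub_apply, Matrix.smul_apply, Matrix.transpose_apply, Matrix.of_apply,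
    Matrix.vecMulVec_apply, hT, e, Pi.star_apply, Complex.star_def, Complex.conj_ofReal,
    smul_eq_mul]
  ring

lemma f_transpose (r s : Fin (d ^ 2)) : f (fun t => (P t).transpose) r s = -fStar P r s := by
  rw [f, fStar, Q_transpose, neg_smul, neg_neg]

lemma SQ_transpose (r : Fin (d ^ 2)) : SQ (fun t => (P t).transpose) r = SQbar P r := by
  rw [SQ, SQbar, Q_transpose]

lemma lineQ_transpose (r s : Fin (d ^ 2)) :
    lineQ (fun t => (P t).transpose) r s = lineQbar P r s := by
  rw [lineQ, lineQbar, f_transpose, WithLp.toLp_neg, ← Set.neg_singleton, Submodule.span_neg]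

lemma restQ_transpose (r s : Fin (d ^ 2)) :
    restQ (fun t => (P t).transpose) r s = restQbar P r s := by
  rw [restQ, restQbar, f_transpose, Q_transpose, star_neg, Matrix.neg_vecMulVec,
    Matrix.vecMulVec_neg, neg_neg]

lemma rankOneProj_conjVec (x : EuclideanSpace ℂ (Fin d)) :
    rankOneProj (conjVec x) = (rankOneProj x).transpose := by
  rw [rankOneProj, rankOneProj, Matrix.transpose_vecMulVec, conjVec, star_star]

end Transpose

/-! ### Angles -/

section Angle

lemma angle_eq_of_mem {ψ p : H d} {U : Submodule ℂ (H d)} (hp : p ∈ U)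
    (h : ∀ u ∈ U, ⟪u, ψ - p⟫_ℂ = 0) : angle ψ U = Real.arccos (‖p‖ / ‖ψ‖) := by
  rw [angle, Submodule.eq_starProjection_of_mem_of_inner_eq_zero hp
    fun u hu => inner_eq_zero_symm.1 (h u hu)]

lemma uniformlyInclinedTo_span_singleton {u v : H d} {m c : ℝ} (hm : 0 < m)
    (hu : ⟪u, u⟫_ℂ = m) (hv : ⟪v, v⟫_ℂ = m) (huv : ‖⟪u, v⟫_ℂ‖ = c * m) :
    UniformlyInclinedTo (Submodule.span ℂ {u}) (Submodule.span ℂ {v}) (Real.arccos c) := by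
  have norm_eq : ∀ w : H d, ⟪w, w⟫_ℂ = m → ‖w‖ = √m := fun w hw => by
    have : ((‖w‖ ^ 2 : ℝ) : ℂ) = m := by
      rw [← hw, inner_self_eq_norm_sq_to_K]
      simp
    rw [← Complex.ofReal_inj.1 this, Real.sqrt_sq (norm_nonneg w)]
  intro ψ hψ hψ0
  obtain ⟨a, rfl⟩ := Submodule.mem_span_singleton.1 hψ
  have ha : ‖a‖ ≠ 0 := norm_ne_zero_iff.2 fun h => hψ0 (by rw [h, zero_smul])
  have hs : √m ≠ 0 := (Real.sqrt_pos.2 hm).ne'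
  have hsm := Real.sq_sqrt hm.le
  rw [angle, Submodule.starProjection_singleton, norm_smul, norm_smul, inner_smul_right, norm_div,
    norm_mul, norm_inner_symm, huv, norm_eq u hu, norm_eq v hv]
  congr 1
  have : ‖((√m : ℝ) : ℂ) ^ 2‖ = m := by
    rw [norm_pow, Complex.norm_real, Real.norm_of_nonneg (Real.sqrt_nonneg m), hsm]
  simp only [Complex.coe_algebraMap, Complex.ofReal_pow, this]
  field_simp

lemma inclined_span_singleton {u v : H d} {m c : ℝ} (hm : 0 < m)
    (hu : ⟪u, u⟫_ℂ = m) (hv : ⟪v, v⟫_ℂ = m) (huv : ‖⟪u, v⟫_ℂ‖ = c * m) :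
    Inclined (Submodule.span ℂ {u}) (Submodule.span ℂ {v}) (Real.arccos c) :=
  ⟨uniformlyInclinedTo_span_singleton hm hu hv huv,
    uniformlyInclinedTo_span_singleton hm hv hu (by rwa [norm_inner_symm])⟩

end Angle

/-! ### Relations within one SIC -/

section Pair

variable {ψ : Fin (d ^ 2) → EuclideanSpace ℂ (Fin d)} {r s : Fin (d ^ 2)}

lemma norm_overlap (h : IsSICFrame ψ) (hrs : r ≠ s) :
    ‖⟪ψ r, ψ s⟫_ℂ‖ ^ 2 = 1 / ((d : ℝ) + 1) := by
  have := h.overlap r s hrs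
  rw [← inner_conj_symm (ψ s), Complex.mul_conj, Complex.normSq_eq_norm_sq] at this
  apply Complex.ofReal_injective
  rw [this]
  push_cast
  rfl

lemma lineQ_le_SQ (h : IsSICFrame ψ) (hrs : r ≠ s) :
    lineQ (fun r => rankOneProj (ψ r)) r s ≤ SQ (fun r => rankOneProj (ψ r)) r := by
  rw [lineQ_eq h hrs, Submodule.span_singleton_le_iff_mem, mem_SQ_iff h]
  exact ⟨_, inner_perp_self (h.inner_self r) _, rfl⟩

lemma restQ_le_SQ (h : IsSICFrame ψ) (hrs : r ≠ s) :
    restQ (fun r => rankOneProj (ψ r)) r s ≤ SQ (fun r => rankOneProj (ψ r)) r := by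
  intro z hz
  obtain ⟨x, hx, -, rfl⟩ := (mem_restQ_iff h hrs z).1 hz
  exact (mem_SQ_iff h r _).2 ⟨x, hx, rfl⟩

lemma SQ_eq_sup (h : IsSICFrame ψ) (hrs : r ≠ s) : SQ (fun r => rankOneProj (ψ r)) r =
    lineQ (fun r => rankOneProj (ψ r)) r s ⊔ restQ (fun r => rankOneProj (ψ r)) r s := by
  refine le_antisymm (fun z hz => ?_) (sup_le (lineQ_le_SQ h hrs) (restQ_le_SQ h hrs))
  have hd := natCast_ne_zero_of_fin_sq r
  have hd' := natCast_add_one_ne_zero d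
  obtain ⟨x, hx, rfl⟩ := (mem_SQ_iff h r z).1 hz
  -- The coefficient is that of the orthogonal projection of `x` on `perp (ψ r) (ψ s)`, whose
  -- squared norm is `d / (d + 1)`.
  refine Submodule.mem_sup.2 ⟨(((d : ℂ) + 1) / (d : ℂ) * ⟪ψ s, x⟫_ℂ) • lineVec ψ r s, ?_,
    frameMap ψ r (x - (((d : ℂ) + 1) / (d : ℂ) * ⟪ψ s, x⟫_ℂ) • perp (ψ r) (ψ s)), ?_, ?_⟩
  · rw [lineQ_eq h hrs]
    exact Submodule.smul_mem _ _ (Submodule.mem_span_singleton_self _)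
  · refine (mem_restQ_iff h hrs _).2 ⟨_, ?_, ?_, rfl⟩
    · rw [inner_sub_right, inner_smul_right, inner_perp_self (h.inner_self r), hx, mul_zero,
        sub_zero]
    · rw [inner_sub_right, inner_smul_right, inner_perp_right_overlap h hrs]
      field_simp
      ring
  · rw [map_sub, map_smul, lineVec, add_sub_cancel]

lemma isOrtho_lineQ_iff (h : IsSICFrame ψ) (hrs : r ≠ s) (U : Submodule ℂ (H d)) :
    Submodule.IsOrtho (lineQ (fun r => rankOneProj (ψ r)) r s) U ↔
      ∀ z ∈ U, ⟪lineVec ψ r s, z⟫_ℂ = 0 := by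
  rw [lineQ_eq h hrs, Submodule.isOrtho_iff_inner_eq]
  constructor
  · exact fun H z hz => H _ (Submodule.mem_span_singleton_self _) z hz
  · intro H u hu z hz
    obtain ⟨a, rfl⟩ := Submodule.mem_span_singleton.1 hu
    rw [inner_smul_left, H z hz, mul_zero]

lemma isOrtho_lineQ_restQ (h : IsSICFrame ψ) (hrs : r ≠ s) :
    Submodule.IsOrtho (lineQ (fun r => rankOneProj (ψ r)) r s)
      (restQ (fun r => rankOneProj (ψ r)) r s) := by
  rw [isOrtho_lineQ_iff h hrs]
  intro z hz
  obtain ⟨x, hx, hx', rfl⟩ := (mem_restQ_iff h hrs z).1 hz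
  rw [lineVec, inner_frameMap_self h _ (inner_perp_self (h.inner_self r) _), inner_perp_left hx,
    hx']

lemma finrank_lineQ (h : IsSICFrame ψ) (hrs : r ≠ s) :
    Module.finrank ℂ (lineQ (fun r => rankOneProj (ψ r)) r s) = 1 := by
  rw [lineQ_eq h hrs]
  refine finrank_span_singleton fun h0 => ?_
  have := inner_lineVec_self h hrs
  rw [h0, inner_zero_left, eq_comm, div_eq_zero_iff] at this
  exact this.elim (natCast_ne_zero_of_fin_sq r) (natCast_add_one_ne_zero d)

lemma finrank_SQ (h : IsSICFrame ψ) (r : Fin (d ^ 2)) :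
    Module.finrank ℂ (SQ (fun r => rankOneProj (ψ r)) r) = d - 1 := by
  have hSQ : SQ (fun r => rankOneProj (ψ r)) r =
      LinearMap.range ((frameMap ψ r).domRestrict (ℂ ∙ ψ r)ᗮ) := by
    ext z
    rw [mem_SQ_iff h]
    constructor
    · rintro ⟨x, hx, rfl⟩
      exact ⟨⟨x, Submodule.mem_orthogonal_singleton_iff_inner_right.2 hx⟩, rfl⟩
    · rintro ⟨⟨x, hx⟩, rfl⟩
      exact ⟨x, Submodule.mem_orthogonal_singleton_iff_inner_right.1 hx, rfl⟩
  have hinj : Function.Injective ((frameMap ψ r).domRestrict (ℂ ∙ ψ r)ᗮ) := by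
    rintro ⟨x, hx⟩ ⟨y, hy⟩ hxy
    have hxy' : frameMap ψ r x = frameMap ψ r y := hxy
    refine Subtype.ext (show x = y from ?_)
    rw [← frameAdj_frameMap h (Submodule.mem_orthogonal_singleton_iff_inner_right.1 hx), hxy',
      frameAdj_frameMap h (Submodule.mem_orthogonal_singleton_iff_inner_right.1 hy)]
  rw [hSQ, LinearMap.finrank_range_of_inj hinj]
  have hne : ψ r ≠ 0 := fun h0 => by
    have := h.inner_self r
    rw [h0, inner_zero_left] at this
    exact zero_ne_one this
  have := (ℂ ∙ ψ r).finrank_add_finrank_orthogonal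
  rw [finrank_span_singleton hne, finrank_euclideanSpace_fin] at this
  omega

lemma finrank_restQ (h : IsSICFrame ψ) (hrs : r ≠ s) :
    Module.finrank ℂ (restQ (fun r => rankOneProj (ψ r)) r s) = d - 2 := by
  have h1 := Submodule.finrank_sup_add_finrank_inf_eq (lineQ (fun r => rankOneProj (ψ r)) r s)
    (restQ (fun r => rankOneProj (ψ r)) r s)
  rw [← SQ_eq_sup h hrs, (isOrtho_lineQ_restQ h hrs).disjoint.eq_bot, finrank_bot, finrank_SQ h,
    finrank_lineQ h hrs] at h1
  -- Here `h1` reads `d - 1 + 0 = 1 + dim`, which forces `2 ≤ d`, so the truncated subtraction is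
  -- harmless.
  omega

lemma isOrtho_lineQ_restQ_swap (h : IsSICFrame ψ) (hrs : r ≠ s) :
    Submodule.IsOrtho (lineQ (fun r => rankOneProj (ψ r)) r s)
      (restQ (fun r => rankOneProj (ψ r)) s r) := by
  rw [isOrtho_lineQ_iff h hrs]
  intro z hz
  obtain ⟨x, hx, hx', rfl⟩ := (mem_restQ_iff h hrs.symm z).1 hz
  rw [lineVec, inner_frameMap_frameMap h, hx, inner_perp_left hx', hx, mul_zero, zero_mul,
    add_zero]

lemma inner_lineVec_swap (h : IsSICFrame ψ) (hrs : r ≠ s) :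
    ⟪lineVec ψ r s, lineVec ψ s r⟫_ℂ =
      -((d : ℂ) / ((d : ℂ) + 1) * (⟪ψ s, ψ r⟫_ℂ * ⟪ψ s, ψ r⟫_ℂ)) := by
  have hd' := natCast_add_one_ne_zero d
  rw [lineVec, lineVec, inner_frameMap_frameMap h, inner_perp_self (h.inner_self s), mul_zero,
    zero_add]
  have hov := h.overlap r s hrs
  have h1 : ⟪perp (ψ r) (ψ s), perp (ψ s) (ψ r)⟫_ℂ = -((d : ℂ) / ((d : ℂ) + 1) * ⟪ψ s, ψ r⟫_ℂ) := by
    simp only [perp, inner_sub_left, inner_sub_right, inner_smul_left, inner_smul_right,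
      h.inner_self, inner_conj_symm]
    have hd1 : (d : ℂ) / ((d : ℂ) + 1) = 1 - 1 / ((d : ℂ) + 1) := by
      field_simp
      ring
    rw [hd1, ← hov]
    ring
  rw [h1]
  ring

lemma inclined_lineQ_lineQ (h : IsSICFrame ψ) (hrs : r ≠ s) :
    Inclined (lineQ (fun r => rankOneProj (ψ r)) r s) (lineQ (fun r => rankOneProj (ψ r)) s r)
      (Real.arccos (1 / ((d : ℝ) + 1))) := by
  have hd : (0 : ℝ) < d := by
    have := natCast_ne_zero_of_fin_sq r
    exact_mod_cast Nat.pos_of_ne_zero fun h0 => this (by rw [h0, Nat.cast_zero])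
  have hd' : (0 : ℝ) < (d : ℝ) + 1 := by positivity
  rw [lineQ_eq h hrs, lineQ_eq h hrs.symm]
  refine inclined_span_singleton (div_pos hd hd') ?_ ?_ ?_
  · rw [inner_lineVec_self h hrs]; push_cast; rfl
  · rw [inner_lineVec_self h hrs.symm]; push_cast; rfl
  · have hn : ‖(d : ℂ) / ((d : ℂ) + 1)‖ = (d : ℝ) / ((d : ℝ) + 1) := by
      rw [← Complex.norm_of_nonneg (div_pos hd hd').le]
      push_cast
      rfl
    rw [inner_lineVec_swap h hrs, norm_neg, norm_mul, norm_mul, hn, ← sq,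
      norm_overlap h hrs.symm]
    ring

lemma uniformlyInclinedTo_restQ_restQ (h : IsSICFrame ψ) (hrs : r ≠ s) :
    UniformlyInclinedTo (restQ (fun r => rankOneProj (ψ r)) r s)
      (restQ (fun r => rankOneProj (ψ r)) s r) (Real.arccos (1 / √((d : ℝ) + 1))) := by
  intro z hz hz0
  obtain ⟨x, hx, hx', rfl⟩ := (mem_restQ_iff h hrs z).1 hz
  have norm_eq : ∀ t, ⟪ψ t, x⟫_ℂ = 0 → ‖frameMap ψ t x‖ = ‖x‖ := fun t ht => by
    rw [@norm_eq_sqrt_re_inner ℂ, inner_frameMap_self h x ht, ← norm_eq_sqrt_re_inner]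
  have hx0 : ‖x‖ ≠ 0 := by
    rw [← norm_eq r hx]
    exact norm_ne_zero_iff.2 hz0
  -- For `x` orthogonal to both vectors the inner product formula leaves only `⟪y, x⟫⟪ψ r, ψ s⟫`, so
  -- the projection is this multiple of `frameMap ψ s x`. The cosine `‖⟪ψ r, ψ s⟫‖` does not depend
  -- on `x`.
  rw [angle_eq_of_mem (p := ⟪ψ r, ψ s⟫_ℂ • frameMap ψ s x)]
  · rw [norm_smul, norm_eq r hx, norm_eq s hx', mul_div_cancel_right₀ _ hx0,
      ← Real.sqrt_sq (norm_nonneg ⟪ψ r, ψ s⟫_ℂ), norm_overlap h hrs, Real.sqrt_div zero_le_one,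
      Real.sqrt_one]
  · exact Submodule.smul_mem _ _ ((mem_restQ_iff h hrs.symm _).2 ⟨x, hx', hx, rfl⟩)
  · intro u hu
    obtain ⟨y, hy, hy', rfl⟩ := (mem_restQ_iff h hrs.symm u).1 hu
    rw [inner_sub_right, inner_smul_right, inner_frameMap_self h x hy, inner_frameMap_frameMap h,
      hx, mul_zero, zero_add, mul_comm, sub_self]

/-! ### Relations between a SIC and its conjugate -/

lemma isOrtho_lineQ_restQ_conj (h : IsSICFrame ψ) (hrs : r ≠ s) :
    Submodule.IsOrtho (lineQ (fun r => rankOneProj (ψ r)) r s)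
      (restQ (fun r => rankOneProj (conjVec (ψ r))) s r) := by
  rw [isOrtho_lineQ_iff h hrs]
  intro z hz
  obtain ⟨x, hx, hx', rfl⟩ := (mem_restQ_iff h.conj hrs.symm z).1 hz
  rw [← conjVec_conjVec x, inner_conjVec_conjVec] at hx hx'
  rw [← conjVec_conjVec x, lineVec, inner_frameMap_frameMap_conj h, hx, hx', mul_zero, mul_zero,
    add_zero]

lemma isOrtho_restQ_restQ_conj (h : IsSICFrame ψ) (hrs : r ≠ s) :
    Submodule.IsOrtho (restQ (fun r => rankOneProj (ψ r)) r s)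
      (restQ (fun r => rankOneProj (conjVec (ψ r))) s r) := by
  rw [Submodule.isOrtho_iff_inner_eq]
  intro w hw z hz
  obtain ⟨y, hy, hy', rfl⟩ := (mem_restQ_iff h hrs w).1 hw
  obtain ⟨x, hx, hx', rfl⟩ := (mem_restQ_iff h.conj hrs.symm z).1 hz
  rw [← conjVec_conjVec x, inner_conjVec_conjVec] at hx hx'
  rw [← conjVec_conjVec x, inner_frameMap_frameMap_conj h, hx, hx', mul_zero, mul_zero,
    add_zero]

lemma lineVec_conj (r s : Fin (d ^ 2)) : lineVec (fun t => conjVec (ψ t)) r s =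
    frameMap (fun t => conjVec (ψ t)) r (conjVec (perp (ψ r) (ψ s))) := by
  rw [lineVec]
  congr 1
  rw [perp, inner_conjVec_conjVec, ← inner_conj_symm]
  ext i
  simp [conjVec, perp]

lemma isOrtho_restQ_lineQ_conj (h : IsSICFrame ψ) (hrs : r ≠ s) :
    Submodule.IsOrtho (restQ (fun r => rankOneProj (ψ r)) r s)
      (lineQ (fun r => rankOneProj (conjVec (ψ r))) s r) := by
  refine Submodule.IsOrtho.symm ((isOrtho_lineQ_iff h.conj hrs.symm _).2 fun z hz => ?_)
  obtain ⟨x, hx, hx', rfl⟩ := (mem_restQ_iff h hrs z).1 hz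
  rw [lineVec_conj, inner_eq_zero_symm, inner_frameMap_frameMap_conj h,
    inner_eq_zero_symm.1 hx, inner_eq_zero_symm.1 hx', zero_mul, zero_mul, add_zero]

/-- Only the cross term survives, a product of two squared norms `d / (d + 1)`; dividing by one of
them gives the cosine. -/
lemma inner_lineVec_conj (h : IsSICFrame ψ) (hrs : r ≠ s) :
    ⟪lineVec ψ r s, lineVec (fun t => conjVec (ψ t)) s r⟫_ℂ =
      (d : ℂ) / ((d : ℂ) + 1) * ((d : ℂ) / ((d : ℂ) + 1)) := by
  have hreal : (starRingEnd ℂ) ((d : ℂ) / ((d : ℂ) + 1)) = (d : ℂ) / ((d : ℂ) + 1) := by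
    simp
  rw [lineVec_conj, lineVec, inner_frameMap_frameMap_conj h,
    inner_eq_zero_symm.1 (inner_perp_self (h.inner_self r) (ψ s)), zero_mul, zero_add,
    ← inner_conj_symm, inner_perp_right_overlap h hrs, ← inner_conj_symm _ (ψ r),
    inner_perp_right_overlap h hrs.symm, hreal]

lemma inclined_lineQ_lineQ_conj (h : IsSICFrame ψ) (hrs : r ≠ s) :
    Inclined (lineQ (fun r => rankOneProj (ψ r)) r s)
      (lineQ (fun r => rankOneProj (conjVec (ψ r))) s r)
      (Real.arccos ((d : ℝ) / ((d : ℝ) + 1))) := by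
  have hd : (0 : ℝ) < d := by
    have := natCast_ne_zero_of_fin_sq r
    exact_mod_cast Nat.pos_of_ne_zero fun h0 => this (by rw [h0, Nat.cast_zero])
  have hd' : (0 : ℝ) < (d : ℝ) + 1 := by positivity
  rw [lineQ_eq h hrs, lineQ_eq h.conj hrs.symm]
  refine inclined_span_singleton (div_pos hd hd') ?_ ?_ ?_
  · rw [inner_lineVec_self h hrs]; push_cast; rfl
  · rw [inner_lineVec_self h.conj hrs.symm]; push_cast; rfl
  · have hn : ‖(d : ℂ) / ((d : ℂ) + 1)‖ = (d : ℝ) / ((d : ℝ) + 1) := by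
      rw [← Complex.norm_of_nonneg (div_pos hd hd').le]
      push_cast
      rfl
    rw [inner_lineVec_conj h hrs, norm_mul, hn]

end Pair

end SIC

theorem theorem16 (d : ℕ) (P : Fin (d ^ 2) → Matrix (Fin d) (Fin d) ℂ) (hP : IsSICSet d P)
    (r s : Fin (d ^ 2)) (hrs : r ≠ s) :
    -- `Q r` and `(Q r)ᵀ` are orthogonal projections
    (IsStarProjection (SIC.Q P r) ∧ IsStarProjection (SIC.Q P r).transpose) ∧
    -- orthogonal decompositions of the ranges of `Q r` and `(Q r)ᵀ`
    (SIC.SQ P r = SIC.lineQ P r s ⊔ SIC.restQ P r s ∧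
      Submodule.IsOrtho (SIC.lineQ P r s) (SIC.restQ P r s) ∧
      Module.finrank ℂ (SIC.lineQ P r s) = 1 ∧
      Module.finrank ℂ (SIC.restQ P r s) = d - 2) ∧
    (SIC.SQbar P r = SIC.lineQbar P r s ⊔ SIC.restQbar P r s ∧
      Submodule.IsOrtho (SIC.lineQbar P r s) (SIC.restQbar P r s) ∧
      Module.finrank ℂ (SIC.lineQbar P r s) = 1 ∧
      Module.finrank ℂ (SIC.restQbar P r s) = d - 2) ∧
    -- relation of the ranges of `Q r` and `Q s`
    (Submodule.IsOrtho (SIC.lineQ P r s) (SIC.restQ P s r) ∧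
      Submodule.IsOrtho (SIC.restQ P r s) (SIC.lineQ P s r) ∧
      SIC.Inclined (SIC.lineQ P r s) (SIC.lineQ P s r) (Real.arccos (1 / ((d : ℝ) + 1))) ∧
      SIC.Inclined (SIC.restQ P r s) (SIC.restQ P s r) (Real.arccos (1 / √((d : ℝ) + 1)))) ∧
    -- relation of the ranges of `(Q r)ᵀ` and `(Q s)ᵀ`
    (Submodule.IsOrtho (SIC.lineQbar P r s) (SIC.restQbar P s r) ∧
      Submodule.IsOrtho (SIC.restQbar P r s) (SIC.lineQbar P s r) ∧
      SIC.Inclined (SIC.lineQbar P r s) (SIC.lineQbar P s r) (Real.arccos (1 / ((d : ℝ) + 1))) ∧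
      SIC.Inclined (SIC.restQbar P r s) (SIC.restQbar P s r)
        (Real.arccos (1 / √((d : ℝ) + 1)))) ∧
    -- relation of the ranges of `Q r` and `(Q s)ᵀ`
    (Submodule.IsOrtho (SIC.lineQ P r s) (SIC.restQbar P s r) ∧
      Submodule.IsOrtho (SIC.restQ P r s) (SIC.lineQbar P s r) ∧
      Submodule.IsOrtho (SIC.restQ P r s) (SIC.restQbar P s r) ∧
      SIC.Inclined (SIC.lineQ P r s) (SIC.lineQbar P s r)
        (Real.arccos ((d : ℝ) / ((d : ℝ) + 1)))) := by
  choose ψ hψ using fun r => SIC.exists_eq_rankOneProj (hP.isStarProjection r) (hP.rank_eq_one r)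
  obtain rfl : P = fun r => SIC.rankOneProj (ψ r) := funext hψ
  have h := SIC.IsSICFrame.of_isSICSet hP
  have hc := h.conj
  have hT : (fun t => (SIC.rankOneProj (ψ t)).transpose) =
      fun t => SIC.rankOneProj (SIC.conjVec (ψ t)) :=
    funext fun t => (SIC.rankOneProj_conjVec (ψ t)).symm
  have hQ := fun r => hT ▸ SIC.Q_transpose (fun t => SIC.rankOneProj (ψ t)) r
  -- All barred subspaces become unbarred ones of the conjugate SIC.
  have hSQ := fun r => hT ▸ SIC.SQ_transpose (fun t => SIC.rankOneProj (ψ t)) r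
  have hline := fun r s => hT ▸ SIC.lineQ_transpose (fun t => SIC.rankOneProj (ψ t)) r s
  have hrest := fun r s => hT ▸ SIC.restQ_transpose (fun t => SIC.rankOneProj (ψ t)) r s
  rw [← hQ, ← hSQ, ← hline, ← hline, ← hrest, ← hrest]
  exact ⟨⟨SIC.isStarProjection_Q h r, SIC.isStarProjection_Q hc r⟩,
    ⟨SIC.SQ_eq_sup h hrs, SIC.isOrtho_lineQ_restQ h hrs, SIC.finrank_lineQ h hrs,
      SIC.finrank_restQ h hrs⟩,
    ⟨SIC.SQ_eq_sup hc hrs, SIC.isOrtho_lineQ_restQ hc hrs, SIC.finrank_lineQ hc hrs,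
      SIC.finrank_restQ hc hrs⟩,
    ⟨SIC.isOrtho_lineQ_restQ_swap h hrs, (SIC.isOrtho_lineQ_restQ_swap h hrs.symm).symm,
      SIC.inclined_lineQ_lineQ h hrs, SIC.uniformlyInclinedTo_restQ_restQ h hrs,
      SIC.uniformlyInclinedTo_restQ_restQ h hrs.symm⟩,
    ⟨SIC.isOrtho_lineQ_restQ_swap hc hrs, (SIC.isOrtho_lineQ_restQ_swap hc hrs.symm).symm,
      SIC.inclined_lineQ_lineQ hc hrs, SIC.uniformlyInclinedTo_restQ_restQ hc hrs,
      SIC.uniformlyInclinedTo_restQ_restQ hc hrs.symm⟩,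
    SIC.isOrtho_lineQ_restQ_conj h hrs, SIC.isOrtho_restQ_lineQ_conj h hrs,
    SIC.isOrtho_restQ_restQ_conj h hrs, SIC.inclined_lineQ_lineQ_conj h hrs⟩
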